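/- Let $c,b_0,b_1,a_0,a_1$ be real numbers with $ca_1b_1\le 0$ and $ca_1\ne 0$, and put $B(z)=b_0+b_1z$ and $A(z)=a_0+a_1z$. Let $(P_m(z))_{m\ge 0}$ be the sequence of real polynomials defined by $$\sum_{m=0}^{\infty}P_m(z)\,t^m=\frac{1}{1+ct+B(z)t^2+A(z)t^3}$$ (an identity of formal power series in $t$). Set $$a=\frac{b_0}{c^2}-\frac{b_1a_0}{c^2a_1},\qquad b=-\frac{b_1c}{a_1}.$$ Then the following are equivalent: (i) for every $m\ge 0$, every complex number $z$ with $P_m(z)=0$ is real; (ii) $1+a+b\ge 0$ and $9-27a+b\ge 0$. -/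

import Mathlib

open Polynomial

/-- The power series `1 + c t + B(z) t² + A(z) t³` in `t` over `ℝ[z]`, where `B(z) = b₀ + b₁ z`
and `A(z) = a₀ + a₁ z`. -/
noncomputable def genDenominator (c b₀ b₁ a₀ a₁ : ℝ) : PowerSeries ℝ[X] :=
  1 + PowerSeries.C (C c) * PowerSeries.X
    + PowerSeries.C (C b₀ + C b₁ * X) * PowerSeries.X ^ 2
    + PowerSeries.C (C a₀ + C a₁ * X) * PowerSeries.X ^ 3

/-- The polynomial `P_m(z)`: the coefficient of `t ^ m` in the reciprocal
`1 / (1 + c t + B(z) t² + A(z) t³)`. -/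
noncomputable def genPoly (c b₀ b₁ a₀ a₁ : ℝ) (m : ℕ) : ℝ[X] :=
  PowerSeries.coeff m (PowerSeries.invOfUnit (genDenominator c b₀ b₁ a₀ a₁) 1)

/-- The series with coefficients `P_m` is indeed the reciprocal of the denominator. -/
theorem mk_genPoly_mul_genDenominator (c b₀ b₁ a₀ a₁ : ℝ) :
    PowerSeries.mk (genPoly c b₀ b₁ a₀ a₁) * genDenominator c b₀ b₁ a₀ a₁ = 1 := by
  have h : PowerSeries.mk (genPoly c b₀ b₁ a₀ a₁)
      = PowerSeries.invOfUnit (genDenominator c b₀ b₁ a₀ a₁) 1 := by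
    ext m : 1
    simp [genPoly]
  rw [h, mul_comm]
  apply PowerSeries.mul_invOfUnit
  simp [genDenominator]

/-!
Rescaling `t` and replacing `z` by `w = A(z) / c³` turns the family into the one generated by
`1 / (1 + t + (a - b w) t² + w t³)`, where the sign hypothesis becomes `b ≥ 0`. Write `H_m` for its
members (`normPoly`). The reciprocals of the zeros in `t` of the denominator are the zeros of the
cubic `x³ + x² + (a - b w) x + w`, and `H_m(w)` is the complete homogeneous symmetric polynomial of
degree `m` in them (`vandermonde_mul_aeval_normPoly`). There is a unique real `σ` with
`b σ³ + σ + a = 0`. If `σ ≠ 0`, the zeros of the cubic at `w = -σ³` are `σ, σ u, σ / u` with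
`1 + u + 1 / u = -1 / σ`, and `u` is non-real, hence of modulus one, if and only if `σ > 1` or
`σ < -1/3`: only then is there a conjugate pair of the same modulus as the real zero. Condition (ii)
says precisely that `-1/3 ≤ σ ≤ 1`.

Sufficiency. In the interior of the region, consider the real `w` for which the cubic has a
conjugate pair `-√R e^{±iφ}`. They are parametrised by the real zero `s`, which runs through a
segment with end point `1 / b`, and there the pair dominates `s` (`realRoot_sq_lt`) while `φ` covers
`(0, π/2)`. At `φ = jπ/(m+2)` the powers `x^(m+2)` of the pair coincide, so the sign of `H_m` there
is known and alternates with `j` (`normPoly_eval_sign`). This gives `⌊m/2⌋ - 1` distinct real zeros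
of a polynomial of degree at most `⌊m/2⌋`, and a last zero cannot be non-real. The boundary of the
region, including `b = 0`, and an exceptional curve inside it follow by perturbing `b` and Hurwitz's theorem
(`eventually_exists_zero_of_tendsto`).

Necessity. If `σ` lies outside `[-1/3, 1]`, then near `w = -σ³` three dominant terms compete. Zooming
in at scale `1 / m` and normalising, `H_m` converges along an ultrafilter to an exponential polynomial
whose three exponents form a triangle in general position. Such a function has non-real zeros
(`exists_nonreal_zero_exp_sum`), and by Hurwitz's theorem so do infinitely many `H_m`.
-/

/-! ### The normalised family -/

/-- The polynomial `H_m(w)`: the coefficient of `t ^ m` in `1 / (1 + t + (a - b w) t² + w t³)`,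
given by the linear recurrence that this reciprocal satisfies. -/
noncomputable def normPoly (a b : ℝ) : ℕ → ℝ[X]
  | 0 => 1
  | 1 => -1
  | 2 => 1 - (C a - C b * X)
  | m + 3 => -normPoly a b (m + 2) - (C a - C b * X) * normPoly a b (m + 1) - X * normPoly a b m

theorem genPoly_recurrence (c b₀ b₁ a₀ a₁ : ℝ) :
    genPoly c b₀ b₁ a₀ a₁ 0 = 1 ∧ genPoly c b₀ b₁ a₀ a₁ 1 = -C c ∧
    genPoly c b₀ b₁ a₀ a₁ 2 = C c ^ 2 - (C b₀ + C b₁ * X) ∧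
    ∀ m, genPoly c b₀ b₁ a₀ a₁ (m + 3) = -C c * genPoly c b₀ b₁ a₀ a₁ (m + 2)
      - (C b₀ + C b₁ * X) * genPoly c b₀ b₁ a₀ a₁ (m + 1)
      - (C a₀ + C a₁ * X) * genPoly c b₀ b₁ a₀ a₁ m := by
  have key : ∀ k, PowerSeries.coeff k (PowerSeries.mk (genPoly c b₀ b₁ a₀ a₁) *
      genDenominator c b₀ b₁ a₀ a₁) = genPoly c b₀ b₁ a₀ a₁ k
        + C c * (if 1 ≤ k then genPoly c b₀ b₁ a₀ a₁ (k - 1) else 0)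
        + (C b₀ + C b₁ * X) * (if 2 ≤ k then genPoly c b₀ b₁ a₀ a₁ (k - 2) else 0)
        + (C a₀ + C a₁ * X) * (if 3 ≤ k then genPoly c b₀ b₁ a₀ a₁ (k - 3) else 0) := by
    intro k
    rw [genDenominator, show ∀ φ : PowerSeries ℝ[X], φ * (1 + PowerSeries.C (C c) * PowerSeries.X
        + PowerSeries.C (C b₀ + C b₁ * X) * PowerSeries.X ^ 2
        + PowerSeries.C (C a₀ + C a₁ * X) * PowerSeries.X ^ 3) =
        φ + PowerSeries.C (C c) * (φ * PowerSeries.X ^ 1)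
        + PowerSeries.C (C b₀ + C b₁ * X) * (φ * PowerSeries.X ^ 2)
        + PowerSeries.C (C a₀ + C a₁ * X) * (φ * PowerSeries.X ^ 3) from fun φ => by ring]
    simp only [map_add (PowerSeries.coeff k), PowerSeries.coeff_C_mul,
      PowerSeries.coeff_mul_X_pow', PowerSeries.coeff_mk]
  simp only [mk_genPoly_mul_genDenominator, PowerSeries.coeff_one] at key
  have h0 : genPoly c b₀ b₁ a₀ a₁ 0 = 1 := by simpa using (key 0).symm
  have h1 : genPoly c b₀ b₁ a₀ a₁ 1 = -C c := by
    have := key 1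
    simp [h0] at this
    linear_combination -this
  have h2 : genPoly c b₀ b₁ a₀ a₁ 2 = C c ^ 2 - (C b₀ + C b₁ * X) := by
    have := key 2
    simp [h0, h1] at this
    linear_combination -this
  refine ⟨h0, h1, h2, fun m => ?_⟩
  have := key (m + 3)
  simp at this
  linear_combination -this

/-- Rescaling `t` by `c` and taking `w = A(z) / c³` as the new variable brings the general family
to the normalised one. -/
theorem aeval_genPoly_eq (c b₀ b₁ a₀ a₁ : ℝ) (hne : c * a₁ ≠ 0) (z : ℂ) (m : ℕ) :
    aeval z (genPoly c b₀ b₁ a₀ a₁ m) = (c : ℂ) ^ m *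
      aeval (((a₀ : ℂ) + a₁ * z) / (c : ℂ) ^ 3)
        (normPoly (b₀ / c ^ 2 - b₁ * a₀ / (c ^ 2 * a₁)) (-(b₁ * c / a₁)) m) := by
  obtain ⟨h0, h1, h2, h3⟩ := genPoly_recurrence c b₀ b₁ a₀ a₁
  have hc : (c : ℂ) ≠ 0 := by exact_mod_cast left_ne_zero_of_mul hne
  have ha : (a₁ : ℂ) ≠ 0 := by exact_mod_cast right_ne_zero_of_mul hne
  induction m using Nat.strong_induction_on with
  | _ m ih =>
    match m with
    | 0 => simp [h0, normPoly]
    | 1 => simp [h1, normPoly]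
    | 2 =>
      simp only [h2, normPoly]
      simp
      field_simp
      ring
    | m + 3 =>
      have i0 := ih m (by omega)
      have i1 := ih (m + 1) (by omega)
      have i2 := ih (m + 2) (by omega)
      simp only [normPoly, h3]
      simp only [map_sub, map_mul, map_neg, map_add, aeval_C, aeval_X, Complex.coe_algebraMap]
      rw [i0, i1, i2]
      push_cast
      field_simp
      ring

/-- Partial fractions: if `x, y, s` are the reciprocals of the zeros of the denominator, then
`H_m` is their complete homogeneous symmetric polynomial of degree `m`. -/
theorem vandermonde_mul_aeval_normPoly (a b : ℝ) (w x y s : ℂ) (h1 : x + y + s = -1)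
    (h2 : x * y + y * s + s * x = a - b * w) (h3 : x * y * s = -w) (m : ℕ) :
    (x - y) * (x - s) * (y - s) * aeval w (normPoly a b m) =
      x ^ (m + 2) * (y - s) - y ^ (m + 2) * (x - s) + s ^ (m + 2) * (x - y) := by
  induction m using Nat.strong_induction_on with
  | _ m ih =>
    match m with
    | 0 => simp [normPoly]; ring
    | 1 =>
      simp only [normPoly]
      simp
      linear_combination (x - y) * (x - s) * (y - s) * (-h1)
    | 2 =>
      simp only [normPoly]
      simp
      rw [← h2]
      have : (1 : ℂ) = (x + y + s) ^ 2 := by rw [h1]; ring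
      rw [this]; ring
    | m + 3 =>
      have i0 := ih m (by omega)
      have i1 := ih (m + 1) (by omega)
      have i2 := ih (m + 2) (by omega)
      simp only [normPoly]
      simp only [map_sub, map_mul, map_neg, aeval_C, aeval_X, Complex.coe_algebraMap]
      rw [← h2, show w = -(x * y * s) by rw [h3]; ring] at *
      linear_combination (x + y + s) * i2 - (x * y + y * s + s * x) * i1 + x * y * s * i0
        - (x - y) * (x - s) * (y - s) * aeval (-(x * y * s)) (normPoly a b (m + 2)) * h1

theorem natDegree_normPoly_le (a b : ℝ) (m : ℕ) : (normPoly a b m).natDegree ≤ m / 2 := by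
  have hB : (C a - C b * X : ℝ[X]).natDegree ≤ 1 := by compute_degree
  induction m using Nat.strong_induction_on with
  | _ m ih =>
    match m with
    | 0 => simp [normPoly]
    | 1 => simp [normPoly]
    | 2 => simp only [normPoly]; compute_degree
    | m + 3 =>
      have i0 := ih m (by omega)
      have i1 := ih (m + 1) (by omega)
      have i2 := ih (m + 2) (by omega)
      simp only [normPoly]
      refine (natDegree_sub_le _ _).trans (max_le ((natDegree_sub_le _ _).trans (max_le ?_ ?_)) ?_)
      · rw [natDegree_neg]; omega
      · have := natDegree_mul_le (p := C a - C b * X) (q := normPoly a b (m + 1)); omega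
      · have := natDegree_mul_le (p := X) (q := normPoly a b m)
        have := natDegree_X_le (R := ℝ)
        omega

theorem continuous_aeval_normPoly (a : ℝ) (m : ℕ) :
    Continuous fun p : ℝ × ℂ => aeval p.2 (normPoly a p.1 m) := by
  induction m using Nat.strong_induction_on with
  | _ m ih =>
    match m with
    | 0 => simp only [normPoly, map_one]; fun_prop
    | 1 => simp only [normPoly, map_neg, map_one]; fun_prop
    | 2 =>
      simp only [normPoly]
      simp only [map_sub, map_mul, map_one, aeval_C, aeval_X, Complex.coe_algebraMap]
      fun_prop
    | m + 3 =>
      have i0 := ih m (by omega)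
      have i1 := ih (m + 1) (by omega)
      have i2 := ih (m + 2) (by omega)
      simp only [normPoly]
      simp only [map_sub, map_mul, map_neg, aeval_C, aeval_X, Complex.coe_algebraMap]
      fun_prop

theorem aeval_ofReal_normPoly (a b : ℝ) (m : ℕ) (w : ℝ) :
    aeval (w : ℂ) (normPoly a b m) = (((normPoly a b m).eval w : ℝ) : ℂ) := by
  rw [← Complex.coe_algebraMap, aeval_algebraMap_apply, coe_aeval_eq_eval]

/-! ### Real zeros and non-vanishing -/

/-- A real polynomial whose known real zeros leave room for at most one more has only real zeros,
because non-real zeros come in conjugate pairs. -/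
theorem im_eq_zero_of_natDegree_le_card_add_one {p : ℝ[X]} (hp : p ≠ 0) (S : Finset ℝ)
    (hS : ∀ x ∈ S, p.eval x = 0) (hdeg : p.natDegree ≤ S.card + 1) (z : ℂ)
    (hz : aeval z p = 0) : z.im = 0 := by
  classical
  by_contra him
  have hpC : p.map (algebraMap ℝ ℂ) ≠ 0 := by
    rwa [Ne, Polynomial.map_eq_zero]
  have hconj : aeval ((starRingEnd ℂ) z) p = 0 := by
    rw [aeval_conj, hz, map_zero]
  set T : Finset ℂ := insert z (insert ((starRingEnd ℂ) z) (S.image (fun x : ℝ => (x : ℂ))))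
  have hT : T.card = S.card + 2 := by
    rw [Finset.card_insert_of_notMem, Finset.card_insert_of_notMem,
      Finset.card_image_of_injective _ Complex.ofReal_injective]
    · intro h
      obtain ⟨x, -, hx⟩ := Finset.mem_image.1 h
      apply him
      have := congrArg Complex.im hx
      simpa using this.symm
    · intro h
      rcases Finset.mem_insert.1 h with h | h
      · exact him (Complex.conj_eq_iff_im.1 h.symm)
      · obtain ⟨x, -, hx⟩ := Finset.mem_image.1 h
        apply him
        rw [← hx]; simp
  have hle : T ⊆ (p.map (algebraMap ℝ ℂ)).roots.toFinset := by
    intro t ht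
    rw [Multiset.mem_toFinset, mem_roots hpC, IsRoot, eval_map_algebraMap]
    rcases Finset.mem_insert.1 ht with rfl | ht
    · exact hz
    rcases Finset.mem_insert.1 ht with rfl | ht
    · exact hconj
    obtain ⟨x, hx, rfl⟩ := Finset.mem_image.1 ht
    rw [← Complex.coe_algebraMap, aeval_algebraMap_apply, coe_aeval_eq_eval, hS x hx, map_zero]
  have h1 := Finset.card_le_card hle
  have h2 := Multiset.toFinset_card_le (p.map (algebraMap ℝ ℂ)).roots
  have h3 := card_roots' (p.map (algebraMap ℝ ℂ))
  rw [natDegree_map] at h3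
  omega

/-- Under the hypotheses `H_m` is not the zero polynomial: for `a ≤ 0` it does not vanish at `0`,
and for `a > 0` it does not vanish at a point where the reciprocals of the zeros of the denominator
are `-p, -p, 2p - 1` with `0 < p ≤ 1/3`, all of them negative. -/
theorem normPoly_ne_zero (a b : ℝ) (h : 0 ≤ 9 - 27 * a + b) (m : ℕ) : normPoly a b m ≠ 0 := by
  suffices H : ∃ w : ℝ, ∀ m, 0 < (-1) ^ m * (normPoly a b m).eval w by
    obtain ⟨w, hw⟩ := H
    intro h0
    simpa [h0] using hw m
  by_cases ha : a ≤ 0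
  · refine ⟨0, fun m => ?_⟩
    induction m using Nat.strong_induction_on with
    | _ m ih =>
      match m with
      | 0 => simp [normPoly]
      | 1 => simp [normPoly]
      | 2 => simp only [normPoly]; simp; linarith
      | m + 3 =>
        have i1 := ih (m + 1) (by omega)
        have i2 := ih (m + 2) (by omega)
        simp only [normPoly]
        simp
        have : (-1 : ℝ) ^ (m + 3) * (-(normPoly a b (m + 2)).eval 0
            - a * (normPoly a b (m + 1)).eval 0) =
            (-1) ^ (m + 2) * (normPoly a b (m + 2)).eval 0
            + (-a) * ((-1) ^ (m + 1) * (normPoly a b (m + 1)).eval 0) := by ring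
        rw [this]
        have := mul_nonneg (neg_nonneg.2 ha) i1.le
        linarith
  · push Not at ha
    obtain ⟨p, hp, hpa⟩ : ∃ p ∈ Set.Icc (0 : ℝ) (1 / 3),
        2 * p - 3 * p ^ 2 + b * (p ^ 2 - 2 * p ^ 3) = a := by
      have := intermediate_value_Icc (f := fun p : ℝ => 2 * p - 3 * p ^ 2 + b * (p ^ 2 - 2 * p ^ 3))
        (by norm_num : (0 : ℝ) ≤ 1 / 3) (by fun_prop)
      exact this ⟨by norm_num; exact ha.le, by norm_num; linarith⟩
    have hp0 : 0 < p := by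
      rcases hp.1.lt_or_eq with h | h
      · exact h
      · subst h; norm_num at hpa; linarith
    refine ⟨p ^ 2 * (1 - 2 * p), ?_⟩
    set Q : ℕ → ℝ := fun m => (-1) ^ m * (normPoly a b m).eval (p ^ 2 * (1 - 2 * p)) with hQ
    have Q0 : Q 0 = 1 := by simp [hQ, normPoly]
    have Q1 : Q 1 = 1 := by simp [hQ, normPoly]
    have Q2 : Q 2 = 1 - (2 * p - 3 * p ^ 2) := by
      simp only [hQ, normPoly]; simp; linear_combination -hpa
    have Q3 : ∀ m, Q (m + 3) = Q (m + 2) - (2 * p - 3 * p ^ 2) * Q (m + 1)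
        + p ^ 2 * (1 - 2 * p) * Q m := by
      intro m
      simp only [hQ, normPoly]
      simp
      linear_combination (-1) ^ m * (-(normPoly a b (m + 1)).eval (p ^ 2 * (1 - 2 * p))) * hpa
    have r0 : 0 < 1 - 2 * p := by have := hp.2; linarith
    have hV : ∀ m, Q (m + 2) - 2 * p * Q (m + 1) + p ^ 2 * Q m = (1 - 2 * p) ^ (m + 2) := by
      intro m
      induction m with
      | zero => simp only [zero_add, Q0, Q1, Q2]; ring
      | succ k ih =>
        linear_combination (1 - 2 * p) * ih + Q3 k
    have hT : ∀ m, 0 < Q (m + 1) - p * Q m := by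
      intro m
      induction m with
      | zero => simp only [zero_add, Q0, Q1]; linarith
      | succ k ih =>
        have := hV k
        have := pow_pos r0 (k + 2)
        nlinarith [mul_pos hp0 ih]
    intro m
    change 0 < Q m
    induction m with
    | zero => rw [Q0]; norm_num
    | succ k ih => nlinarith [hT k, mul_pos hp0 ih]

/-! ### Hurwitz's theorem -/

open Filter Topology in
/-- Hurwitz's theorem for a family of entire functions converging locally uniformly (in the form
of joint convergence in index and variable): near a zero of a non-zero limit, all sufficiently late
members of the family have zeros. -/
theorem eventually_exists_zero_of_tendsto {ι : Type*} {l : Filter ι} {f : ι → ℂ → ℂ} {F : ℂ → ℂ}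
    (hf : ∀ i, Differentiable ℂ (f i)) (hF : Differentiable ℂ F)
    (hlim : ∀ z, Tendsto (fun p : ι × ℂ => f p.1 p.2) (l ×ˢ 𝓝 z) (𝓝 (F z)))
    {z₀ z₁ : ℂ} (h0 : F z₀ = 0) (h1 : F z₁ ≠ 0) {U : Set ℂ} (hU : U ∈ 𝓝 z₀) :
    ∀ᶠ i in l, ∃ z ∈ U, f i z = 0 := by
  have hne : ∀ᶠ z in 𝓝[≠] z₀, F z ≠ 0 := by
    rcases (hF.analyticAt z₀).eventually_eq_zero_or_eventually_ne_zero with h | h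
    · have := AnalyticOnNhd.eq_of_eventuallyEq (f := F) (g := fun _ => 0) (z₀ := z₀)
        (fun z _ => hF.analyticAt z) (fun z _ => analyticAt_const) h
      exact absurd (congrFun this z₁) h1
    · exact h
  obtain ⟨ε, hε, hball⟩ := Metric.mem_nhds_iff.1
    (inter_mem hU (eventually_nhdsWithin_iff.1 hne))
  set r := ε / 2 with hr
  have hr0 : 0 < r := by positivity
  have hsub : Metric.closedBall z₀ r ⊆ Metric.ball z₀ ε :=
    Metric.closedBall_subset_ball (by rw [hr]; linarith)
  have hsph : ∀ z ∈ Metric.sphere z₀ r, F z ≠ 0 := fun z hz =>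
    (hball (hsub (Metric.sphere_subset_closedBall hz))).2
      (Metric.ne_of_mem_sphere hz hr0.ne')
  have hcpt : IsCompact (Metric.sphere z₀ r) := isCompact_sphere z₀ r
  obtain ⟨y, hy, hmin⟩ := hcpt.exists_isMinOn
    (NormedSpace.sphere_nonempty.2 hr0.le) hF.continuous.norm.continuousOn
  set δ := ‖F y‖ / 2 with hδ
  have hδ0 : 0 < δ := half_pos (norm_pos_iff.2 (hsph y hy))
  have hlow : ∀ᶠ i in l, ∀ z ∈ Metric.sphere z₀ r, δ < ‖f i z‖ := by
    refine hcpt.induction_on (p := fun s => ∀ᶠ i in l, ∀ z ∈ s, δ < ‖f i z‖)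
      (by simp) (fun s t hst ht => ht.mono fun i hi z hz => hi z (hst hz))
      (fun s t hs ht => by
        filter_upwards [hs, ht] with i h1 h2 z hz using hz.elim (h1 z) (h2 z)) ?_
    intro z hz
    have hz' : δ < ‖F z‖ := by
      have : ‖F y‖ ≤ ‖F z‖ := hmin hz
      linarith
    have := (hlim z).norm.eventually (lt_mem_nhds hz')
    obtain ⟨A, hA, B, hB, hAB⟩ := eventually_prod_iff.1 this
    exact ⟨{w | B w}, mem_nhdsWithin_of_mem_nhds hB, hA.mono fun i hi w hw => hAB hi hw⟩
  have hcen : ∀ᶠ i in l, ‖f i z₀‖ < δ := by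
    have h := (hlim z₀).comp (tendsto_id.prodMk (tendsto_const_nhds (x := z₀) (f := l)))
    rw [h0] at h
    have := h.norm
    rw [norm_zero] at this
    exact this.eventually (gt_mem_nhds hδ0)
  filter_upwards [hlow, hcen] with i hi hc
  by_contra! hno
  have hnz : ∀ z ∈ Metric.closedBall z₀ r, f i z ≠ 0 := fun z hz => hno z (hball (hsub hz)).1
  -- The reciprocal of `f i` would violate the maximum modulus principle.
  have hd : DiffContOnCl ℂ (fun z => (f i z)⁻¹) (Metric.ball z₀ r) := by
    apply DifferentiableOn.diffContOnCl
    rw [closure_ball z₀ hr0.ne']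
    exact (hf i).differentiableOn.inv hnz
  have hmax := Complex.norm_le_of_forall_mem_frontier_norm_le Metric.isBounded_ball hd (C := δ⁻¹)
    (fun z hz => by
      rw [frontier_ball z₀ hr0.ne'] at hz
      rw [norm_inv]
      exact inv_anti₀ hδ0 (hi z hz).le) (subset_closure (Metric.mem_ball_self hr0))
  rw [norm_inv] at hmax
  have hpos : 0 < ‖f i z₀‖ := norm_pos_iff.2 (hnz z₀ (Metric.mem_closedBall_self hr0.le))
  rw [inv_le_inv₀ hpos hδ0] at hmax
  linarith

/-! ### Real zeros along the curve of conjugate pairs -/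

/-- Suppose that at a real `w` the cubic `x³ + x² + (a - b w) x + w` has the real zero `s` and a pair
of zeros with product `R`. If the pair is `-√R e^{±iφ}` with `φ = jπ/(m+2)`, its `(m+2)`-th powers
coincide, and the sign of `H_m(w)` is determined as soon as the pair dominates `s`. -/
theorem normPoly_eval_sign {a b s R w : ℝ} {m j : ℕ} (hw : w = -(s * R))
    (h2 : R - s * (1 + s) = a - b * w) (hR : s ^ 2 < R)
    (hj : 0 < j) (hjm : j < m + 2)
    (hcos : 1 + s = 2 * √R * Real.cos (j * Real.pi / (m + 2))) :
    0 < (-1) ^ (m + j + 1) * (normPoly a b m).eval w := by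
  set φ : ℝ := j * Real.pi / (m + 2) with hφ
  have hR0 : 0 < R := lt_of_le_of_lt (sq_nonneg s) hR
  set ρ := √R with hρ
  have hρ0 : 0 < ρ := Real.sqrt_pos.2 hR0
  have hρ2 : ρ ^ 2 = R := Real.sq_sqrt hR0.le
  have hm : (0 : ℝ) < m + 2 := by positivity
  have hsin : 0 < Real.sin φ := by
    apply Real.sin_pos_of_pos_of_lt_pi
    · rw [hφ]; have := Real.pi_pos; positivity
    · rw [hφ, div_lt_iff₀ hm, mul_comm]
      have : (j : ℝ) < m + 2 := by exact_mod_cast hjm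
      exact mul_lt_mul_of_pos_left this Real.pi_pos
  set x : ℂ := -(ρ * Complex.exp (φ * Complex.I)) with hx
  set y : ℂ := -(ρ * Complex.exp (-(φ * Complex.I))) with hy
  have hexp : Complex.exp (φ * Complex.I) * Complex.exp (-(φ * Complex.I)) = 1 := by
    rw [← Complex.exp_add]; simp
  have hxy : x * y = (R : ℂ) := by
    rw [hx, hy, ← hρ2]; push_cast; linear_combination (ρ : ℂ) ^ 2 * hexp
  have hsum : x + y = -(1 + s : ℂ) := by
    have : (1 + s : ℂ) = 2 * ρ * Complex.cos φ := by exact_mod_cast hcos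
    rw [this, Complex.cos, hx, hy, neg_mul]; ring
  have hpow : Complex.exp (φ * Complex.I) ^ (m + 2) = (-1) ^ j := by
    rw [← Complex.exp_nat_mul, ← Complex.exp_pi_mul_I, ← Complex.exp_nat_mul]
    congr 1
    rw [hφ]; push_cast
    have : (m + 2 : ℂ) ≠ 0 := by exact_mod_cast hm.ne'
    field_simp
  have hpow' : Complex.exp (-(φ * Complex.I)) ^ (m + 2) = (-1) ^ j := by
    rw [Complex.exp_neg, inv_pow, hpow, ← inv_pow]; norm_num
  have hxn : x ^ (m + 2) = (-1) ^ (m + j) * ρ ^ (m + 2) := by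
    rw [hx, neg_pow, mul_pow, hpow]; ring
  have hyn : y ^ (m + 2) = (-1) ^ (m + j) * ρ ^ (m + 2) := by
    rw [hy, neg_pow, mul_pow, hpow']; ring
  have hne : x - y ≠ 0 := by
    have : x - y = -(2 * ρ * Real.sin φ : ℝ) * Complex.I := by
      rw [hx, hy]; push_cast
      rw [Complex.sin, neg_mul (φ : ℂ)]
      linear_combination (ρ * (Complex.exp (-(φ * Complex.I)) - Complex.exp (φ * Complex.I))) *
        Complex.I_sq
    rw [this]
    refine mul_ne_zero (neg_ne_zero.2 ?_) Complex.I_ne_zero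
    exact_mod_cast (by positivity : (2 * ρ * Real.sin φ) ≠ 0)
  have key := vandermonde_mul_aeval_normPoly a b w x y s (by rw [hsum]; ring)
    (by
      have : (R - s * (1 + s) : ℂ) = a - b * w := by exact_mod_cast h2
      rw [← this]; linear_combination hxy + s * hsum)
    (by rw [hxy, hw]; push_cast; ring) m
  rw [hxn, hyn, aeval_ofReal_normPoly] at key
  have hD : ((s ^ 2 + s * (1 + s) + R) * (normPoly a b m).eval w : ℝ)
      = s ^ (m + 2) - (-1) ^ (m + j) * ρ ^ (m + 2) := by
    have : (((s ^ 2 + s * (1 + s) + R) * (normPoly a b m).eval w : ℝ) : ℂ)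
        = ((s ^ (m + 2) - (-1) ^ (m + j) * ρ ^ (m + 2) : ℝ) : ℂ) := by
      apply mul_left_cancel₀ hne
      push_cast
      rw [← hxy]
      linear_combination key + (x - y) * s * (((normPoly a b m).eval w : ℝ) : ℂ) * hsum
    exact_mod_cast this
  have hDpos : 0 < s ^ 2 + s * (1 + s) + R := by
    rw [hcos, ← hρ2, show s ^ 2 + s * (2 * ρ * Real.cos φ) + ρ ^ 2
      = (s + ρ * Real.cos φ) ^ 2 + (ρ * Real.sin φ) ^ 2 by
        linear_combination (-ρ ^ 2) * Real.sin_sq_add_cos_sq φ]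
    positivity
  have hsρ : |s ^ (m + 2)| < ρ ^ (m + 2) := by
    rw [abs_pow]
    refine pow_lt_pow_left₀ ?_ (abs_nonneg s) (by omega)
    exact abs_lt_of_sq_lt_sq (by rw [hρ2]; exact hR) hρ0.le
  refine (mul_pos_iff_of_pos_left hDpos).1 ?_
  rw [show (s ^ 2 + s * (1 + s) + R) * ((-1) ^ (m + j + 1) * (normPoly a b m).eval w)
    = (-1) ^ (m + j + 1) * ((s ^ 2 + s * (1 + s) + R) * (normPoly a b m).eval w) by ring, hD]
  have hab := abs_lt.1 hsρ
  rcases neg_one_pow_eq_or ℝ (m + j) with h | h <;> rw [pow_succ, h] <;> linarith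

/-- The point `s` of the segment from `s₀` to `1 / b` with parameter `l`. It is the real reciprocal zero
along the curve on which the other two are a conjugate pair. -/
noncomputable def realRoot (b s₀ l : ℝ) : ℝ := (1 - l) * s₀ + l / b

/-- The squared modulus `(s² + s + a) / (1 - b s)` of the conjugate pair of reciprocal zeros that goes
with the real one, `s`. The denominator is written out in terms of the parameter `l`. -/
noncomputable def pairNormSq (a b s₀ l : ℝ) : ℝ :=
  (realRoot b s₀ l ^ 2 + realRoot b s₀ l + a) / ((1 - l) * (1 - b * s₀))

/-- The value of the variable `w` along the curve. -/
noncomputable def curveParam (a b s₀ l : ℝ) : ℝ := -(realRoot b s₀ l * pairNormSq a b s₀ l)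

/-- The square `(1 + s)² / (4 R)`, where `R` is `pairNormSq`, of the cosine of the argument of the
conjugate pair. Unlike `R` it extends continuously to `l = 1`, where it vanishes. -/
noncomputable def pairCosSq (a b s₀ l : ℝ) : ℝ :=
  (1 + realRoot b s₀ l) ^ 2 * ((1 - l) * (1 - b * s₀)) /
    (4 * (realRoot b s₀ l ^ 2 + realRoot b s₀ l + a))

section Curve

variable {a b s₀ l : ℝ}

theorem one_sub_mul_realRoot (hb : 0 < b) :
    1 - b * realRoot b s₀ l = (1 - l) * (1 - b * s₀) := by
  rw [realRoot]; field_simp; ring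

theorem neg_third_lt_realRoot (hb : 0 < b) (hs : -(1 / 3) < s₀) (hl0 : 0 ≤ l) (hl1 : l ≤ 1) :
    -(1 / 3) < realRoot b s₀ l := by
  have : 0 < 1 / b := by positivity
  have h1 : l / b = l * (1 / b) := by ring
  rw [realRoot, h1]
  rcases hl0.eq_or_lt with rfl | h
  · linarith
  · nlinarith [mul_pos h this]

/-- `4 (s² + s + a) - (1 + s)² (1 - b s)` vanishes at `s₀` and increases to the right of `-1/3`, so
it has the sign of `1 - b s₀` along the curve: the pair is not real. -/
theorem discrim_pos (hb : 0 < b) (hs : -(1 / 3) < s₀) (hnd : 1 - b * s₀ ≠ 0)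
    (hk : 3 * s₀ ^ 2 + 2 * s₀ + 4 * a - 1 + b * s₀ * (1 + s₀) ^ 2 = 0)
    (hl0 : 0 < l) (hl1 : l ≤ 1) :
    0 < (1 - b * s₀) * (4 * (realRoot b s₀ l ^ 2 + realRoot b s₀ l + a)
      - (1 + realRoot b s₀ l) ^ 2 * (1 - b * realRoot b s₀ l)) := by
  have hs' := neg_third_lt_realRoot hb hs hl0.le hl1
  have hdiff : realRoot b s₀ l - s₀ = l * (1 - b * s₀) / b := by
    rw [realRoot]; field_simp; ring
  set s := realRoot b s₀ l
  have hK : 0 < 3 * (s + s₀) + 2 + b * (1 + 2 * (s + s₀) + (s ^ 2 + s * s₀ + s₀ ^ 2)) := by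
    have : 0 < 1 + 2 * (s + s₀) + (s ^ 2 + s * s₀ + s₀ ^ 2) := by
      nlinarith [mul_pos (by linarith : 0 < s + 1 / 3) (by linarith : 0 < s₀ + 1 / 3),
        sq_nonneg (s + 1 / 3), sq_nonneg (s₀ + 1 / 3)]
    have := mul_pos hb this
    linarith
  have heq : (1 - b * s₀) * (4 * (s ^ 2 + s + a) - (1 + s) ^ 2 * (1 - b * s)) =
      l * (1 - b * s₀) ^ 2 / b *
        (3 * (s + s₀) + 2 + b * (1 + 2 * (s + s₀) + (s ^ 2 + s * s₀ + s₀ ^ 2))) := by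
    rw [show l * (1 - b * s₀) ^ 2 / b = (1 - b * s₀) * (l * (1 - b * s₀) / b) by ring, ← hdiff]
    linear_combination (1 - b * s₀) * hk
  rw [heq]
  positivity

theorem quad_realRoot_pos (hb : 0 < b) (hs : -(1 / 3) < s₀) (hnd : 1 - b * s₀ ≠ 0)
    (hk : 3 * s₀ ^ 2 + 2 * s₀ + 4 * a - 1 + b * s₀ * (1 + s₀) ^ 2 = 0)
    (hl0 : 0 ≤ l) (hl1 : l ≤ 1) :
    0 < (1 - b * s₀) * (realRoot b s₀ l ^ 2 + realRoot b s₀ l + a) := by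
  rcases hl0.eq_or_lt with rfl | h
  · have : realRoot b s₀ 0 = s₀ := by simp [realRoot]
    rw [this, show (1 - b * s₀) * (s₀ ^ 2 + s₀ + a) = (1 - b * s₀) ^ 2 * (1 + s₀) ^ 2 / 4 by
      linear_combination (1 - b * s₀) / 4 * hk]
    have : 0 < 1 + s₀ := by linarith
    positivity
  · have h1 := discrim_pos hb hs hnd hk h hl1
    rw [one_sub_mul_realRoot hb] at h1
    have : 0 ≤ (1 + realRoot b s₀ l) ^ 2 * ((1 - l) * (1 - b * s₀) ^ 2) :=
      mul_nonneg (sq_nonneg _) (mul_nonneg (by linarith) (sq_nonneg _))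
    nlinarith

theorem lt_four_mul_pairNormSq (hb : 0 < b) (hs : -(1 / 3) < s₀) (hnd : 1 - b * s₀ ≠ 0)
    (hk : 3 * s₀ ^ 2 + 2 * s₀ + 4 * a - 1 + b * s₀ * (1 + s₀) ^ 2 = 0)
    (hl0 : 0 < l) (hl1 : l < 1) :
    (1 + realRoot b s₀ l) ^ 2 < 4 * pairNormSq a b s₀ l := by
  have h1 := discrim_pos hb hs hnd hk hl0 hl1.le
  rw [one_sub_mul_realRoot hb] at h1
  have hl : 0 < 1 - l := by linarith
  have hl' := hl.ne'
  rw [← sub_pos, show 4 * pairNormSq a b s₀ l - (1 + realRoot b s₀ l) ^ 2 =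
    ((1 - b * s₀) * (4 * (realRoot b s₀ l ^ 2 + realRoot b s₀ l + a)
      - (1 + realRoot b s₀ l) ^ 2 * ((1 - l) * (1 - b * s₀)))) / ((1 - l) * (1 - b * s₀) ^ 2) by
      rw [pairNormSq]; field_simp]
  positivity

/-- The conjugate pair dominates the real reciprocal zero along the whole curve. -/
theorem realRoot_sq_lt (hb : 0 < b) (hs : -(1 / 3) < s₀) (hs1 : s₀ < 1) (hnd : 1 - b * s₀ ≠ 0)
    (hk : 3 * s₀ ^ 2 + 2 * s₀ + 4 * a - 1 + b * s₀ * (1 + s₀) ^ 2 = 0)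
    (hl0 : 0 < l) (hl1 : l < 1) :
    realRoot b s₀ l ^ 2 < pairNormSq a b s₀ l := by
  have hdiff : realRoot b s₀ l - s₀ = l * (1 - b * s₀) / b := by
    rw [realRoot]; field_simp; ring
  have h1 := one_sub_mul_realRoot (s₀ := s₀) (l := l) hb
  have hl : 0 < 1 - l := by linarith
  have hl' := hl.ne'
  rw [← sub_pos, pairNormSq]
  set s := realRoot b s₀ l
  have hK : 0 < 1 + b * (s ^ 2 + s * s₀ + s₀ ^ 2) := by
    have : 0 ≤ s ^ 2 + s * s₀ + s₀ ^ 2 := by nlinarith [sq_nonneg (s + s₀), sq_nonneg s, sq_nonneg s₀]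
    positivity
  have hg : (1 - b * s₀) * (b * s ^ 3 + s + a) =
      l * (1 - b * s₀) ^ 2 / b * (1 + b * (s ^ 2 + s * s₀ + s₀ ^ 2))
        + (1 - b * s₀) ^ 2 * (1 - s₀) * (1 + 3 * s₀) / 4 := by
    rw [show l * (1 - b * s₀) ^ 2 / b = (1 - b * s₀) * (l * (1 - b * s₀) / b) by ring, ← hdiff]
    linear_combination (1 - b * s₀) / 4 * hk
  have e1 : 0 < 1 - s₀ := by linarith
  have e2 : 0 < 1 + 3 * s₀ := by linarith
  rw [show (s ^ 2 + s + a) / ((1 - l) * (1 - b * s₀)) - s ^ 2 =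
      ((1 - b * s₀) * (b * s ^ 3 + s + a)) / ((1 - l) * (1 - b * s₀) ^ 2) by
      field_simp
      linear_combination s ^ 2 * h1, hg]
  positivity

theorem pairNormSq_sub (hb : 0 < b) (hnd : 1 - b * s₀ ≠ 0) (hl1 : l < 1) :
    pairNormSq a b s₀ l - realRoot b s₀ l * (1 + realRoot b s₀ l)
      = a - b * curveParam a b s₀ l := by
  have h1 := one_sub_mul_realRoot (s₀ := s₀) (l := l) hb
  have hl : 1 - l ≠ 0 := by linarith
  have h2 : pairNormSq a b s₀ l * (1 - b * realRoot b s₀ l)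
      = realRoot b s₀ l ^ 2 + realRoot b s₀ l + a := by
    rw [h1, pairNormSq]; field_simp
  rw [curveParam]
  linear_combination h2

/-- A real cubic has only one conjugate pair of zeros, so it determines the point of the curve. -/
theorem curveParam_injOn (hb : 0 < b) (hs : -(1 / 3) < s₀) (hnd : 1 - b * s₀ ≠ 0)
    (hk : 3 * s₀ ^ 2 + 2 * s₀ + 4 * a - 1 + b * s₀ * (1 + s₀) ^ 2 = 0) :
    Set.InjOn (curveParam a b s₀) (Set.Ioo 0 1) := by
  intro l hl l' hl' h
  have e1 := pairNormSq_sub (a := a) hb hnd hl.2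
  have e2 := pairNormSq_sub (a := a) hb hnd hl'.2
  have d1 := lt_four_mul_pairNormSq hb hs hnd hk hl.1 hl.2
  have hw1 : curveParam a b s₀ l = -(realRoot b s₀ l * pairNormSq a b s₀ l) := rfl
  have hw2 : curveParam a b s₀ l' = -(realRoot b s₀ l' * pairNormSq a b s₀ l') := rfl
  have key : realRoot b s₀ l = realRoot b s₀ l' := by
    rw [← h] at e2 hw2
    generalize curveParam a b s₀ l = w at *
    generalize realRoot b s₀ l = s at *
    generalize realRoot b s₀ l' = s' at *
    generalize pairNormSq a b s₀ l = R at *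
    generalize pairNormSq a b s₀ l' = R' at *
    have : (s' - s) * (s' ^ 2 + (1 + s) * s' + R) = 0 := by
      linear_combination s' * e1 - s' * e2 - hw1 + hw2
    rcases mul_eq_zero.1 this with h | h
    · linarith
    · nlinarith [sq_nonneg (2 * s' + (1 + s))]
  have : (l - l') * (1 - b * s₀) = 0 := by
    rw [realRoot, realRoot] at key
    field_simp at key
    linear_combination key
  rcases mul_eq_zero.1 this with h | h
  · linarith
  · exact absurd h hnd

theorem continuous_realRoot : Continuous (realRoot b s₀) := by
  unfold realRoot; fun_prop

theorem continuousOn_curveParam (hnd : 1 - b * s₀ ≠ 0) :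
    ContinuousOn (curveParam a b s₀) (Set.Ioo 0 1) := by
  have h := continuous_realRoot (b := b) (s₀ := s₀)
  unfold curveParam pairNormSq
  refine (h.continuousOn.mul (ContinuousOn.div (by fun_prop) (by fun_prop) ?_)).neg
  intro l hl
  exact mul_ne_zero (by linarith [hl.2]) hnd

theorem continuousOn_pairCosSq (hb : 0 < b) (hs : -(1 / 3) < s₀) (hnd : 1 - b * s₀ ≠ 0)
    (hk : 3 * s₀ ^ 2 + 2 * s₀ + 4 * a - 1 + b * s₀ * (1 + s₀) ^ 2 = 0) :
    ContinuousOn (pairCosSq a b s₀) (Set.Icc 0 1) := by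
  have h := continuous_realRoot (b := b) (s₀ := s₀)
  unfold pairCosSq
  refine ContinuousOn.div (by fun_prop) (by fun_prop) ?_
  intro l hl
  have := quad_realRoot_pos hb hs hnd hk hl.1 hl.2
  exact mul_ne_zero (by norm_num) (right_ne_zero_of_mul this.ne')

/-- The sign of `H_m` at the points of the curve where the pair has argument `±jπ/(m+2)` up to a
half-turn. -/
theorem normPoly_eval_curveParam_sign (hb : 0 < b) (hs : -(1 / 3) < s₀) (hs1 : s₀ < 1)
    (hnd : 1 - b * s₀ ≠ 0)
    (hk : 3 * s₀ ^ 2 + 2 * s₀ + 4 * a - 1 + b * s₀ * (1 + s₀) ^ 2 = 0)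
    (hl0 : 0 < l) (hl1 : l < 1) {m j : ℕ} (hj : 0 < j) (hjm : 2 * j < m + 2)
    (hcos : 0 < Real.cos (j * Real.pi / (m + 2)))
    (hq : pairCosSq a b s₀ l = Real.cos (j * Real.pi / (m + 2)) ^ 2) :
    0 < (-1) ^ (m + j + 1) * (normPoly a b m).eval (curveParam a b s₀ l) := by
  have hR := realRoot_sq_lt hb hs hs1 hnd hk hl0 hl1
  refine normPoly_eval_sign rfl (pairNormSq_sub hb hnd hl1) hR hj (by omega) ?_
  have hR0 : 0 ≤ pairNormSq a b s₀ l := (sq_nonneg _).trans hR.le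
  have hs' := neg_third_lt_realRoot hb hs hl0.le hl1.le
  have hN := right_ne_zero_of_mul (quad_realRoot_pos hb hs hnd hk hl0.le hl1.le).ne'
  have hl' : 1 - l ≠ 0 := by linarith
  rw [← pow_left_inj₀ (by linarith) (by positivity) two_ne_zero, mul_pow, mul_pow,
    Real.sq_sqrt hR0, ← hq, pairCosSq, pairNormSq]
  generalize realRoot b s₀ l ^ 2 + realRoot b s₀ l + a = N at *
  field_simp
  norm_num

end Curve

theorem cos_mul_pi_div_pos {m j : ℕ} (hjm : 2 * j < m + 2) :
    0 < Real.cos (j * Real.pi / (m + 2)) := by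
  have hπ := Real.pi_pos
  have hm : (0 : ℝ) < m + 2 := by positivity
  have h2 : (2 * j : ℝ) < m + 2 := by exact_mod_cast hjm
  apply Real.cos_pos_of_mem_Ioo
  constructor
  · have : 0 ≤ (j : ℝ) * Real.pi / (m + 2) := by positivity
    linarith
  · rw [div_lt_div_iff₀ hm two_pos]
    nlinarith

theorem cos_succ_mul_pi_div_sq_lt {m j : ℕ} (hjm : 2 * (j + 1) < m + 2) :
    Real.cos ((j + 1 : ℕ) * Real.pi / (m + 2)) ^ 2 < Real.cos (j * Real.pi / (m + 2)) ^ 2 := by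
  have hπ := Real.pi_pos
  have hm : (0 : ℝ) < m + 2 := by positivity
  refine pow_lt_pow_left₀ ?_ (cos_mul_pi_div_pos hjm).le two_ne_zero
  apply Real.strictAntiOn_cos
  · have h2 : (j : ℝ) ≤ m + 2 := by exact_mod_cast (by omega : j ≤ m + 2)
    refine ⟨by positivity, ?_⟩
    rw [div_le_iff₀ hm]; nlinarith
  · have h2 : ((j + 1 : ℕ) : ℝ) ≤ m + 2 := by exact_mod_cast (by omega : j + 1 ≤ m + 2)
    refine ⟨by positivity, ?_⟩
    rw [div_le_iff₀ hm]; nlinarith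
  · push_cast
    gcongr
    linarith

/-- Between consecutive arguments `jπ/(m+2)` of the pair the polynomial `H_m` changes sign. The
points are found in increasing order of the parameter, so monotonicity of the argument is not
needed. -/
theorem exists_finset_zeros {a b s₀ : ℝ} (hb : 0 < b) (hs : -(1 / 3) < s₀) (hs1 : s₀ < 1)
    (hnd : 1 - b * s₀ ≠ 0)
    (hk : 3 * s₀ ^ 2 + 2 * s₀ + 4 * a - 1 + b * s₀ * (1 + s₀) ^ 2 = 0) (m i : ℕ)
    (hi : 2 * (i + 1) < m + 2) :
    ∃ l ∈ Set.Ioo (0 : ℝ) 1, pairCosSq a b s₀ l = Real.cos ((i + 1 : ℕ) * Real.pi / (m + 2)) ^ 2 ∧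
      ∃ S : Finset ℝ, S.card = i ∧
        ∀ t ∈ S, t ∈ Set.Ioo 0 l ∧ (normPoly a b m).eval (curveParam a b s₀ t) = 0 := by
  have hq1 : pairCosSq a b s₀ 1 = 0 := by simp [pairCosSq]
  have hcont := continuousOn_pairCosSq hb hs hnd hk
  have step : ∀ l ∈ Set.Ico (0 : ℝ) 1, ∀ j : ℕ, 2 * (j + 1) < m + 2 →
      pairCosSq a b s₀ l = Real.cos (j * Real.pi / (m + 2)) ^ 2 →
      ∃ l' ∈ Set.Ioo l 1,
        pairCosSq a b s₀ l' = Real.cos ((j + 1 : ℕ) * Real.pi / (m + 2)) ^ 2 := by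
    intro l hl j hj hq
    have hlt := cos_succ_mul_pi_div_sq_lt hj
    have hpos := pow_pos (cos_mul_pi_div_pos hj) 2
    obtain ⟨l', hl', h⟩ := intermediate_value_Icc' hl.2.le
      (hcont.mono (Set.Icc_subset_Icc_left hl.1))
      (show Real.cos ((j + 1 : ℕ) * Real.pi / (m + 2)) ^ 2 ∈ Set.Icc _ _ from
        ⟨by rw [hq1]; exact hpos.le, by rw [hq]; exact hlt.le⟩)
    refine ⟨l', ⟨lt_of_le_of_ne hl'.1 ?_, lt_of_le_of_ne hl'.2 ?_⟩, h⟩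
    · rintro rfl; linarith
    · rintro rfl; linarith
  induction i with
  | zero =>
    have h0 : pairCosSq a b s₀ 0 = Real.cos ((0 : ℕ) * Real.pi / (m + 2)) ^ 2 := by
      have hN := right_ne_zero_of_mul (quad_realRoot_pos hb hs hnd hk le_rfl zero_le_one).ne'
      have e : realRoot b s₀ 0 = s₀ := by simp [realRoot]
      rw [e] at hN
      simp only [pairCosSq, e]
      simp
      rw [div_eq_one_iff_eq (mul_ne_zero four_ne_zero hN)]
      linear_combination -hk
    obtain ⟨l, hl, hq⟩ := step 0 ⟨le_rfl, one_pos⟩ 0 hi h0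
    exact ⟨l, hl, hq, ∅, rfl, by simp⟩
  | succ i ih =>
    obtain ⟨l, hl, hq, S, hcard, hS⟩ := ih (by omega)
    obtain ⟨l', hl', hq'⟩ := step l ⟨hl.1.le, hl.2⟩ (i + 1) hi hq
    have hl0' : 0 < l' := hl.1.trans hl'.1
    have s1 := normPoly_eval_curveParam_sign hb hs hs1 hnd hk hl.1 hl.2 (m := m) (j := i + 1)
      (by omega) (by omega) (cos_mul_pi_div_pos (by omega)) hq
    have s2 := normPoly_eval_curveParam_sign hb hs hs1 hnd hk hl0' hl'.2 (m := m) (j := i + 1 + 1)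
      (by omega) hi (cos_mul_pi_div_pos hi) hq'
    have hc : ContinuousOn (fun t => (-1) ^ (m + (i + 1) + 1) *
        (normPoly a b m).eval (curveParam a b s₀ t)) (Set.Icc l l') := by
      refine continuousOn_const.mul ((normPoly a b m).continuous.comp_continuousOn
        ((continuousOn_curveParam hnd).mono ?_))
      intro t ht
      exact ⟨hl.1.trans_le ht.1, ht.2.trans_lt hl'.2⟩
    have s2' : (-1) ^ (m + (i + 1) + 1) * (normPoly a b m).eval (curveParam a b s₀ l') < 0 := by
      rw [show m + (i + 1 + 1) + 1 = m + (i + 1) + 1 + 1 by ring, pow_succ] at s2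
      linarith
    obtain ⟨t, ht, h0⟩ := intermediate_value_Icc' hl'.1.le hc ⟨s2'.le, s1.le⟩
    have h0' : (normPoly a b m).eval (curveParam a b s₀ t) = 0 := by
      rcases mul_eq_zero.1 h0 with h | h
      · exact absurd h (pow_ne_zero _ (by norm_num))
      · exact h
    have htl : l < t := lt_of_le_of_ne ht.1 (by rintro rfl; simp only at h0; linarith)
    have htl' : t < l' := lt_of_le_of_ne ht.2 (by rintro rfl; simp only at h0; linarith)
    refine ⟨l', ⟨hl0', hl'.2⟩, hq', insert t S, ?_, ?_⟩
    · rw [Finset.card_insert_of_notMem, hcard]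
      intro hmem
      have := (hS t hmem).1.2
      linarith
    · intro u hu
      rcases Finset.mem_insert.1 hu with rfl | hu
      · exact ⟨⟨hl.1.trans htl, htl'⟩, h0'⟩
      · have := hS u hu
        exact ⟨⟨this.1.1, this.1.2.trans hl'.1⟩, this.2⟩

/-- Hyperbolicity in the interior of the parameter region, away from the curve `a b² + b + 1 = 0`,
on which the cubic has the zero `1 / b` for every `w` and cannot be parametrised by its real zero. -/
theorem im_eq_zero_of_interior {a b : ℝ} (hb : 0 < b) (h1 : 0 < 1 + a + b)
    (h2 : 0 < 9 - 27 * a + b) (hirr : a * b ^ 2 + b + 1 ≠ 0) (m : ℕ) (z : ℂ)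
    (hz : aeval z (normPoly a b m) = 0) : z.im = 0 := by
  obtain ⟨s₀, hs, hk⟩ : ∃ s₀ ∈ Set.Icc (-(1 / 3) : ℝ) 1,
      3 * s₀ ^ 2 + 2 * s₀ + 4 * a - 1 + b * s₀ * (1 + s₀) ^ 2 = 0 := by
    have := intermediate_value_Icc
      (f := fun s : ℝ => 3 * s ^ 2 + 2 * s + 4 * a - 1 + b * s * (1 + s) ^ 2)
      (by norm_num : (-(1 / 3) : ℝ) ≤ 1) (by fun_prop)
    exact this ⟨by norm_num; linarith, by norm_num; linarith⟩
  have hs0 : -(1 / 3) < s₀ := lt_of_le_of_ne hs.1 (by rintro rfl; norm_num at hk; linarith)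
  have hs1 : s₀ < 1 := lt_of_le_of_ne hs.2 (by rintro rfl; norm_num at hk; linarith)
  have hnd : 1 - b * s₀ ≠ 0 := by
    intro h
    apply hirr
    have hbs : b * s₀ = 1 := by linarith
    linear_combination (b ^ 2 / 4) * hk + (b * s₀ + b + 1) * h
      + (b ^ 2 * (1 + s₀) ^ 2 / 4) * h
  have hne := normPoly_ne_zero a b h2.le m
  rcases Nat.eq_zero_or_pos (m / 2) with hm | hm
  · refine im_eq_zero_of_natDegree_le_card_add_one hne ∅ (by simp) ?_ z hz
    have := natDegree_normPoly_le a b m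
    omega
  · obtain ⟨l, hl, -, S, hcard, hS⟩ := exists_finset_zeros hb hs0 hs1 hnd hk m (m / 2 - 1) (by omega)
    refine im_eq_zero_of_natDegree_le_card_add_one hne (S.image (curveParam a b s₀)) ?_ ?_ z hz
    · intro x hx
      obtain ⟨t, ht, rfl⟩ := Finset.mem_image.1 hx
      exact (hS t ht).2
    · rw [Finset.card_image_of_injOn, hcard]
      · have := natDegree_normPoly_le a b m
        omega
      · refine (curveParam_injOn hb hs0 hnd hk).mono ?_
        intro t ht
        have := (hS t ht).1
        exact ⟨this.1, this.2.trans hl.2⟩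

open Filter Topology in
/-- Hyperbolicity on the closed parameter region, by perturbing `b` into the interior and
Hurwitz's theorem. -/
theorem im_eq_zero_of_mem_region {a b : ℝ} (hb : 0 ≤ b) (h1 : 0 ≤ 1 + a + b)
    (h2 : 0 ≤ 9 - 27 * a + b) (m : ℕ) (z : ℂ)
    (hz : aeval z (normPoly a b m) = 0) : z.im = 0 := by
  by_contra him
  obtain ⟨z₁, hz₁⟩ : ∃ z₁ : ℂ, aeval z₁ (normPoly a b m) ≠ 0 := by
    by_contra! h
    have hp : (normPoly a b m).map (algebraMap ℝ ℂ) ≠ 0 := by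
      rw [Ne, Polynomial.map_eq_zero]; exact normPoly_ne_zero a b h2 m
    apply hp
    apply Polynomial.funext
    intro x
    rw [eval_map_algebraMap, h x, eval_zero]
  have hU : {x : ℂ | x.im ≠ 0} ∈ 𝓝 z :=
    (isOpen_ne_fun Complex.continuous_im continuous_const).mem_nhds him
  have hev := eventually_exists_zero_of_tendsto (l := 𝓝[>] (0 : ℝ))
    (f := fun ε z => aeval z (normPoly a (b + ε) m)) (F := fun z => aeval z (normPoly a b m))
    (fun ε => (normPoly a (b + ε) m).differentiable_aeval)
    (normPoly a b m).differentiable_aeval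
    (fun w => by
      have hc : Continuous fun p : ℝ × ℂ => aeval p.2 (normPoly a (b + p.1) m) :=
        (continuous_aeval_normPoly a m).comp
          (f := fun p : ℝ × ℂ => (b + p.1, p.2)) (by fun_prop)
      have := hc.tendsto (0, w)
      rw [nhds_prod_eq] at this
      simp only [add_zero] at this
      exact this.mono_left (prod_mono_left _ nhdsWithin_le_nhds))
    hz hz₁ hU
  -- The excluded curve meets this line of parameters in finitely many points.
  have hirr : ∀ᶠ ε in 𝓝[>] (0 : ℝ), a * (b + ε) ^ 2 + (b + ε) + 1 ≠ 0 := by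
    have hp : (C a * (C b + X) ^ 2 + (C b + X) + 1 : ℝ[X]) ≠ 0 := by
      intro h
      have := congrArg (eval (-b)) h
      simp at this
    have hfin : {ε : ℝ | (C a * (C b + X) ^ 2 + (C b + X) + 1 : ℝ[X]).IsRoot ε}.Finite :=
      finite_setOfPred_isRoot hp
    have := (hfin.subset (Set.sdiff_subset (t := {(0 : ℝ)}))).isClosed.isOpen_compl.mem_nhds
      (x := (0 : ℝ)) (by simp)
    filter_upwards [nhdsWithin_le_nhds this, self_mem_nhdsWithin] with ε hε hpos h
    apply hε
    refine ⟨?_, (ne_of_gt hpos : ε ≠ 0)⟩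
    simpa [IsRoot] using h
  obtain ⟨ε, ⟨w, hw, hw0⟩, hε, hpos⟩ :=
    (hev.and (hirr.and self_mem_nhdsWithin)).exists
  have hpos : 0 < ε := hpos
  exact hw (im_eq_zero_of_interior (by linarith) (by linarith) (by linarith) hε m w hw0)

/-! ### Exponential limits and their zeros -/

open Filter Topology in
theorem tendsto_div_add_two {l : Filter ℕ} (hl : l ≤ atTop) (ζ : ℂ) :
    Tendsto (fun p : ℕ × ℂ => p.2 / ((p.1 : ℂ) + 2)) (l ×ˢ 𝓝 ζ) (𝓝 0) := by
  have h1 : Tendsto (fun n : ℕ => ((n : ℂ) + 2)⁻¹) l (𝓝 0) := by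
    have := (tendsto_inv_atTop_nhds_zero_nat (𝕜 := ℂ)).comp
      ((tendsto_add_atTop_nat 2).comp (tendsto_id.mono_left hl))
    refine this.congr fun n => ?_
    simp
  have := (tendsto_snd (f := l) (g := 𝓝 ζ)).mul (h1.comp (tendsto_fst (f := l) (g := 𝓝 ζ)))
  simpa [div_eq_mul_inv] using this

open Filter Topology in
/-- The limit `(1 + g' ζ / n + o(1 / n)) ^ n → exp (g' ζ)`, locally uniformly in `ζ`. -/
theorem tendsto_pow_exp {l : Filter ℕ} (hl : l ≤ atTop) {g : ℂ → ℂ} {g' : ℂ}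
    (hg : HasDerivAt g g' 0) (hg0 : g 0 = 1) (ζ : ℂ) :
    Tendsto (fun p : ℕ × ℂ => g (p.2 / (p.1 + 2)) ^ (p.1 + 2)) (l ×ˢ 𝓝 ζ)
      (𝓝 (Complex.exp (g' * ζ))) := by
  have hL : HasDerivAt (fun w => Complex.log (g w)) g' 0 := by
    have := hg.clog (by rw [hg0]; exact Complex.one_mem_slitPlane)
    simpa [hg0] using this
  set D := dslope (fun w => Complex.log (g w)) 0 with hD
  have hD0 : D 0 = g' := by rw [hD, dslope_same, hL.deriv]
  have hDc : ContinuousAt D 0 := continuousAt_dslope_same.2 hL.differentiableAt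
  have hw := tendsto_div_add_two hl ζ
  have hne : ∀ᶠ w in 𝓝 (0 : ℂ), g w ≠ 0 :=
    hg.continuousAt.eventually_ne (by rw [hg0]; exact one_ne_zero)
  have hlim : Tendsto (fun p : ℕ × ℂ => Complex.exp (D (p.2 / (p.1 + 2)) * p.2)) (l ×ˢ 𝓝 ζ)
      (𝓝 (Complex.exp (g' * ζ))) := by
    have h1 : Tendsto D (𝓝 0) (𝓝 g') := by rw [← hD0]; exact hDc
    exact (Complex.continuous_exp.tendsto _).comp ((h1.comp hw).mul tendsto_snd)
  refine hlim.congr' ?_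
  filter_upwards [hw.eventually hne] with p hp
  set w := p.2 / ((p.1 : ℂ) + 2) with hwdef
  have hn : (p.1 : ℂ) + 2 ≠ 0 := by exact_mod_cast (by omega : p.1 + 2 ≠ 0)
  have h2 : w * D w = Complex.log (g w) := by
    have := sub_smul_dslope (fun w => Complex.log (g w)) 0 w
    simpa [hg0] using this
  have h3 : D w * p.2 = ((p.1 + 2 : ℕ) : ℂ) * Complex.log (g w) := by
    rw [← h2, hwdef]; push_cast; field_simp
  rw [h3, Complex.exp_nat_mul, Complex.exp_log hp]

open Topology in
/-- A simple zero `u` of the cubic at `w = 0` continues to a zero that is differentiable in `w`. -/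
theorem exists_root_branch {τ β u d : ℂ} (hu : u ^ 3 - τ * u ^ 2 + τ * u - 1 = 0)
    (hd : d = 3 * u ^ 2 - 2 * τ * u + τ) (hd0 : d ≠ 0) (hβ : 1 - β * u ≠ 0) :
    ∃ Y : ℂ → ℂ, Y 0 = u ∧ HasDerivAt Y ((1 - β * u) / d) 0 ∧
      ∀ᶠ w in 𝓝 (0 : ℂ), Y w ^ 3 - τ * Y w ^ 2 + (τ + β * w) * Y w - (1 + w) = 0 := by
  have hQ : HasStrictDerivAt (fun y : ℂ => y ^ 3 - τ * y ^ 2 + τ * y - 1) d u := by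
    have := (((hasStrictDerivAt_pow 3 u).sub ((hasStrictDerivAt_pow 2 u).const_mul τ)).add
      ((hasStrictDerivAt_id u).const_mul τ)).sub_const 1
    rw [show d = ((3 : ℕ) : ℂ) * u ^ (3 - 1) - τ * (((2 : ℕ) : ℂ) * u ^ (2 - 1)) + τ * 1 by
      rw [hd]; norm_num; ring]
    exact this
  have hP : HasStrictDerivAt (fun y : ℂ => 1 - β * y) (-β) u := by
    have := ((hasStrictDerivAt_id u).const_mul β).const_sub 1
    simpa using this
  have hW : HasStrictDerivAt (fun y : ℂ => (y ^ 3 - τ * y ^ 2 + τ * y - 1) / (1 - β * y))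
      (d / (1 - β * u)) u := by
    rw [show d / (1 - β * u) = (d * (1 - β * u) - (u ^ 3 - τ * u ^ 2 + τ * u - 1) * -β) /
      (1 - β * u) ^ 2 by rw [hu]; field_simp; ring]
    exact hQ.div hP hβ
  set W : ℂ → ℂ := fun y : ℂ => (y ^ 3 - τ * y ^ 2 + τ * y - 1) / (1 - β * y) with hWdef
  have hne : d / (1 - β * u) ≠ 0 := div_ne_zero hd0 hβ
  have hWu : W u = 0 := by simp only [hWdef]; rw [hu, zero_div]
  set Y := hW.localInverse W (d / (1 - β * u)) u hne with hY
  have hY0 : Y 0 = u := by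
    have := (hW.hasStrictFDerivAt_equiv hne).localInverse_apply_image
    rw [hWu] at this
    exact this
  have hYd : HasDerivAt Y ((1 - β * u) / d) 0 := by
    have := (hW.to_localInverse hne).hasDerivAt
    rw [hWu, inv_div] at this
    exact this
  have hr : ∀ᶠ w in 𝓝 (0 : ℂ), W (Y w) = w := by
    have := (hW.hasStrictFDerivAt_equiv hne).eventually_right_inverse
    rw [hWu] at this
    exact this
  have hne' : ∀ᶠ w in 𝓝 (0 : ℂ), 1 - β * Y w ≠ 0 := by
    have : ContinuousAt (fun w => 1 - β * Y w) 0 :=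
      continuousAt_const.sub (continuousAt_const.mul hYd.continuousAt)
    exact this.eventually_ne (by rw [hY0]; exact hβ)
  refine ⟨Y, hY0, hYd, ?_⟩
  filter_upwards [hr, hne'] with w h1 h2
  simp only [hWdef] at h1
  rw [div_eq_iff h2] at h1
  linear_combination h1

open Filter Topology in
/-- An exponential polynomial whose three exponents `0, δ, conj δ` form a triangle in general
position has non-real zeros: far out along the line on which the first two terms balance and the
third is negligible. -/
theorem exists_nonreal_zero_exp_sum {A B E δ : ℂ} (hA : A ≠ 0) (hB : B ≠ 0) (hre : δ.re ≠ 0)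
    (him : δ.im ≠ 0) :
    (∃ ζ : ℂ, ζ.im ≠ 0 ∧
      A + B * Complex.exp (δ * ζ) + E * Complex.exp ((starRingEnd ℂ) δ * ζ) = 0) ∧
    ∃ ζ : ℂ, A + B * Complex.exp (δ * ζ) + E * Complex.exp ((starRingEnd ℂ) δ * ζ) ≠ 0 := by
  have hδ : δ ≠ 0 := by rintro rfl; simp at hre
  set δ' := (starRingEnd ℂ) δ with hδ'
  set κ := δ' / δ with hκ
  have hκδ : κ * δ = δ' := div_mul_cancel₀ _ hδ
  have hκim : κ.im ≠ 0 := by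
    intro h
    have e1 := congrArg Complex.re hκδ
    have e2 := congrArg Complex.im hκδ
    simp only [Complex.mul_re, Complex.mul_im, h, hδ', Complex.conj_re, Complex.conj_im] at e1 e2
    have k1 : κ.re = 1 := mul_right_cancel₀ hre (by linarith)
    rw [k1] at e2
    apply him; linarith
  -- The direction in which the third term decays relative to the other two.
  obtain ⟨ε, hε, hεκ⟩ : ∃ ε : ℂ, (ε = 1 ∨ ε = -1) ∧ (κ * (ε * Complex.I)).re < 0 := by
    rcases lt_or_gt_of_ne hκim with h | h
    · exact ⟨-1, Or.inr rfl, by simpa using h⟩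
    · exact ⟨1, Or.inl rfl, by simpa using h⟩
  have hper : ∀ k : ℕ, Complex.exp (k * (2 * Real.pi * (ε * Complex.I))) = 1 := by
    intro k
    rw [Complex.exp_nat_mul]
    have : Complex.exp (2 * Real.pi * (ε * Complex.I)) = 1 := by
      rcases hε with rfl | rfl
      · rw [one_mul, Complex.exp_two_pi_mul_I]
      · rw [show (2 * Real.pi * (-1 * Complex.I) : ℂ) = -(2 * Real.pi * Complex.I) by ring,
          Complex.exp_neg, Complex.exp_two_pi_mul_I, inv_one]
    rw [this, one_pow]
  set L := Complex.log (-A / B) with hL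
  have hexpL : B * Complex.exp L = -A := by
    rw [hL, Complex.exp_log (div_ne_zero (neg_ne_zero.2 hA) hB)]; field_simp
  set ζ : ℕ → ℂ := fun k => (L + k * (2 * Real.pi * (ε * Complex.I))) / δ with hζ
  set q := Complex.exp (κ * (2 * Real.pi * (ε * Complex.I))) with hq
  have hqlt : ‖q‖ < 1 := by
    rw [hq, Complex.norm_exp, Real.exp_lt_one_iff,
      show κ * (2 * Real.pi * (ε * Complex.I)) = ((2 * Real.pi : ℝ) : ℂ) * (κ * (ε * Complex.I)) by
        push_cast; ring, Complex.re_ofReal_mul]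
    exact mul_neg_of_pos_of_neg (by positivity) hεκ
  have hE : Tendsto (fun k : ℕ => E * Complex.exp (κ * L) * q ^ k) atTop (𝓝 0) := by
    have := (tendsto_pow_atTop_nhds_zero_of_norm_lt_one hqlt).const_mul (E * Complex.exp (κ * L))
    simpa using this
  -- Centred at `ζ k`, where the first two terms cancel, the sum is this one.
  have hG : ∀ k η, A + B * Complex.exp (δ * (ζ k + η)) + E * Complex.exp (δ' * (ζ k + η))
      = A * (1 - Complex.exp (δ * η))
        + E * Complex.exp (κ * L) * q ^ k * Complex.exp (δ' * η) := by
    intro k η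
    have e1 : δ * (ζ k + η) = L + k * (2 * Real.pi * (ε * Complex.I)) + δ * η := by
      simp only [hζ]; field_simp
    have e2 : δ' * (ζ k + η) = κ * L + k * (κ * (2 * Real.pi * (ε * Complex.I))) + δ' * η := by
      simp only [hζ, hκ]; field_simp
    rw [e1, e2, Complex.exp_add, Complex.exp_add, hper, Complex.exp_add, Complex.exp_add,
      Complex.exp_nat_mul, ← hq]
    linear_combination Complex.exp (δ * η) * hexpL
  have hlim : ∀ z, Tendsto (fun p : ℕ × ℂ => A + B * Complex.exp (δ * (ζ p.1 + p.2))
      + E * Complex.exp (δ' * (ζ p.1 + p.2))) (atTop ×ˢ 𝓝 z)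
      (𝓝 (A * (1 - Complex.exp (δ * z)))) := by
    intro z
    simp only [hG]
    have c1 : Tendsto (fun p : ℕ × ℂ => A * (1 - Complex.exp (δ * p.2))) (atTop ×ˢ 𝓝 z)
        (𝓝 (A * (1 - Complex.exp (δ * z)))) :=
      ((by fun_prop : Continuous fun w : ℂ => A * (1 - Complex.exp (δ * w))).tendsto z).comp
        tendsto_snd
    have c2 : Tendsto (fun p : ℕ × ℂ => Complex.exp (δ' * p.2)) (atTop ×ˢ 𝓝 z)
        (𝓝 (Complex.exp (δ' * z))) :=
      ((by fun_prop : Continuous fun w : ℂ => Complex.exp (δ' * w)).tendsto z).comp tendsto_snd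
    have := c1.add ((hE.comp tendsto_fst).mul c2)
    simpa using this
  have h1 : A * (1 - Complex.exp (δ * (Real.pi * Complex.I / δ))) ≠ 0 := by
    rw [mul_div_cancel₀ _ hδ, Complex.exp_pi_mul_I]
    exact mul_ne_zero hA (by norm_num)
  constructor
  · have hz := eventually_exists_zero_of_tendsto (l := atTop)
      (f := fun k η => A + B * Complex.exp (δ * (ζ k + η)) + E * Complex.exp (δ' * (ζ k + η)))
      (F := fun η => A * (1 - Complex.exp (δ * η))) (fun k => by fun_prop) (by fun_prop) hlim
      (z₀ := 0) (by simp) h1 (Metric.ball_mem_nhds 0 one_pos)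
    set c := (2 * Real.pi * (ε * Complex.I) / δ).im with hc
    have hc0 : c ≠ 0 := by
      have hne : (ε * Complex.I / δ).im ≠ 0 := by
        have hn : Complex.normSq δ ≠ 0 := by rwa [Ne, Complex.normSq_eq_zero]
        rcases hε with rfl | rfl <;> simp [Complex.div_im, hre, hn]
      rw [hc, show 2 * Real.pi * (ε * Complex.I) / δ
        = ((2 * Real.pi : ℝ) : ℂ) * (ε * Complex.I / δ) by push_cast; ring, Complex.im_ofReal_mul]
      exact mul_ne_zero (by positivity) hne
    have hfar : ∀ᶠ k : ℕ in atTop, (1 + |(L / δ).im|) / |c| ≤ (k : ℝ) :=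
      tendsto_natCast_atTop_atTop.eventually_ge_atTop _
    obtain ⟨k, ⟨η, hη, h0⟩, hk⟩ := (hz.and hfar).exists
    refine ⟨ζ k + η, ?_, h0⟩
    intro hi
    have hζim : (ζ k).im = (L / δ).im + k * c := by
      simp only [hζ]
      rw [add_div, Complex.add_im, mul_div_assoc, hc]
      congr 1
      rw [← Complex.ofReal_natCast, Complex.im_ofReal_mul]
    rw [Complex.add_im, hζim] at hi
    have hη1 : |η.im| < 1 := (Complex.abs_im_le_norm η).trans_lt (by simpa using hη)
    rw [div_le_iff₀ (abs_pos.2 hc0)] at hk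
    have h2 : |(k : ℝ) * c| = k * |c| := by rw [abs_mul, Nat.abs_cast]
    have h3 : (k : ℝ) * c = -((L / δ).im + η.im) := by linarith
    have h4 := abs_add_le (L / δ).im η.im
    rw [h3, abs_neg] at h2
    linarith
  · have := (hlim (Real.pi * Complex.I / δ)).comp
      (tendsto_id.prodMk (tendsto_const_nhds (x := (Real.pi * Complex.I / δ : ℂ)) (f := atTop)))
    obtain ⟨k, hk⟩ := (this.eventually_ne h1).exists
    exact ⟨_, hk⟩

/-! ### Non-real zeros outside the region -/

open Filter Topology ComplexConjugate in
/-- Outside the parameter region some `H_m` has a non-real zero. The real number `σ` is the real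
reciprocal zero at the value of `w` for which all three have the same modulus; the other two are
`σ u` and `σ ū` with `u` on the unit circle. Zooming in on that value at scale `1 / m` turns `H_m`
into an exponential polynomial with non-real zeros. -/
theorem exists_nonreal_zero {a b σ : ℝ} (hb : 0 ≤ b) (hg : b * σ ^ 3 + σ + a = 0)
    (hσ : 1 < σ ∨ σ < -(1 / 3)) :
    ∃ (m : ℕ) (z : ℂ), aeval z (normPoly a b m) = 0 ∧ z.im ≠ 0 := by
  have hσ0 : σ ≠ 0 := by rcases hσ with h | h <;> intro h0 <;> rw [h0] at h <;> norm_num at h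
  set p : ℝ := (-1 / σ - 1) / 2 with hp
  have hτσ : σ * (1 + 2 * p) = -1 := by rw [hp]; field_simp; ring
  have hp1 : p < 1 ∧ -1 < p := by
    rcases hσ with h | h
    · constructor <;> nlinarith
    · constructor <;> nlinarith
  set q : ℝ := √(1 - p ^ 2) with hq
  have hpq : 0 < 1 - p ^ 2 := by nlinarith [hp1.1, hp1.2]
  have hq0 : 0 < q := Real.sqrt_pos.2 hpq
  have hq2 : q ^ 2 = 1 - p ^ 2 := Real.sq_sqrt hpq.le
  set β : ℝ := b * σ with hβ
  set u : ℂ := ⟨p, q⟩ with hu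
  have huu : u * conj u = 1 := by
    apply Complex.ext
    · simp [hu]; linarith
    · simp [hu]; ring
  have hus : u + conj u = 2 * p := by
    apply Complex.ext
    · simp [hu]; ring
    · simp [hu]
  have hsub : u - conj u ≠ 0 := by
    intro h
    have := congrArg Complex.im h
    simp [hu] at this
    exact hq0.ne' this
  have hu1 : u - 1 ≠ 0 := by
    intro h
    have := congrArg Complex.im h
    simp [hu] at this
    exact hq0.ne' this
  have hu1' : conj u - 1 ≠ 0 := by
    intro h
    have := congrArg Complex.im h
    simp [hu] at this
    exact hq0.ne' this
  have hβu : (1 : ℂ) - β * u ≠ 0 := by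
    intro h
    have h1 := congrArg Complex.im h
    have h2 := congrArg Complex.re h
    simp [hu] at h1 h2
    rcases h1 with h1 | h1
    · rw [h1] at h2; norm_num at h2
    · exact hq0.ne' h1
  have hβu' : (1 : ℂ) - β * conj u ≠ 0 := by
    intro h
    apply hβu
    have := congrArg conj h
    simpa using this
  have hp1' : 1 - p ≠ 0 := by linarith [hp1.1]
  -- The derivative at `0` of the branch of zeros through `u`.
  set v : ℂ := ⟨-(1 - β) / (4 * (1 - p)), (1 + β) / (4 * q)⟩ with hv
  have hvd : v = (1 - β * u) / ((u - 1) * (u - conj u)) := by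
    rw [eq_div_iff (mul_ne_zero hu1 hsub)]
    apply Complex.ext
    · simp [hv, hu]; field_simp; linear_combination (2 * (1 - β)) * hq2
    · simp [hv, hu]; field_simp; ring
  have hvd' : conj v = (1 - β * conj u) / ((conj u - 1) * (conj u - u)) := by
    rw [hvd]; simp
  have hcub : u ^ 3 - (1 + 2 * p : ℂ) * u ^ 2 + (1 + 2 * p) * u - 1 = 0 := by
    rw [← hus]; linear_combination (-u + 1) * huu
  have hcub' : conj u ^ 3 - (1 + 2 * p : ℂ) * conj u ^ 2 + (1 + 2 * p) * conj u - 1 = 0 := by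
    rw [← hus]; linear_combination (-conj u + 1) * huu
  obtain ⟨Y₁, Y₁0, Y₁d, Y₁r⟩ := exists_root_branch (β := β) hcub
    (d := (u - 1) * (u - conj u)) (by rw [← hus]; linear_combination huu)
    (mul_ne_zero hu1 hsub) hβu
  obtain ⟨Y₂, Y₂0, Y₂d, Y₂r⟩ := exists_root_branch (β := β) hcub'
    (d := (conj u - 1) * (conj u - u)) (by rw [← hus]; linear_combination huu)
    (mul_ne_zero hu1' (by rw [← neg_sub]; exact neg_ne_zero.2 hsub)) hβu'
  rw [← hvd] at Y₁d
  rw [← hvd'] at Y₂d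
  set Y₀ : ℂ → ℂ := fun w => (1 + 2 * p : ℂ) - Y₁ w - Y₂ w with hY₀
  have Y₀0 : Y₀ 0 = 1 := by simp only [hY₀]; rw [Y₁0, Y₂0]; linear_combination -hus
  set α₀ : ℂ := -(v + conj v) with hα₀
  have Y₀d : HasDerivAt Y₀ α₀ 0 := by
    have := (Y₁d.const_sub (1 + 2 * p : ℂ)).sub Y₂d
    refine this.congr_deriv ?_
    rw [hα₀]; ring
  -- The difference of the logarithmic derivatives of the branches through `u` and `1`.
  set δ : ℂ := v * conj u + (v + conj v) with hδ
  have hδre : δ.re ≠ 0 := by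
    have e : δ.re = (3 * β - 1 - 2 * p) / (4 * (1 - p)) := by
      simp [hδ, hv, hu]; field_simp; ring
    rw [e]
    refine div_ne_zero ?_ (by positivity)
    intro h
    have h1 : 3 * (b * σ ^ 2) + 1 = 0 := by rw [hβ] at h; linear_combination σ * h + hτσ
    have := mul_nonneg hb (sq_nonneg σ)
    linarith
  have hδim : δ.im ≠ 0 := by
    have e : δ.im = (1 + 2 * p - β) / (4 * q) := by
      simp [hδ, hv, hu]; field_simp; linear_combination (1 - β) * hq2
    rw [e]
    refine div_ne_zero ?_ (by positivity)
    intro h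
    have h1 : b * σ ^ 2 + 1 = 0 := by rw [hβ] at h; linear_combination (-σ) * h + hτσ
    have := mul_nonneg hb (sq_nonneg σ)
    linarith
  -- Along an ultrafilter the powers of `u` converge.
  have hnu : ‖u‖ = 1 := by
    have h1 := Complex.mul_conj' u
    rw [huu] at h1
    have h2 : ‖u‖ ^ 2 = 1 := by exact_mod_cast h1.symm
    exact (pow_eq_one_iff_of_nonneg (norm_nonneg u) two_ne_zero).1 h2
  set l : Ultrafilter ℕ := hyperfilter ℕ with hl
  have hlat : (l : Filter ℕ) ≤ atTop := Nat.hyperfilter_le_atTop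
  obtain ⟨lam, hlam, hlim⟩ : ∃ lam ∈ Metric.sphere (0 : ℂ) 1,
      Tendsto (fun m : ℕ => u ^ (m + 2)) l (𝓝 lam) := by
    have := isCompact_iff_ultrafilter_le_nhds.1 (isCompact_sphere (0 : ℂ) 1)
      (l.map fun m => u ^ (m + 2)) (show Tendsto (fun m : ℕ => u ^ (m + 2)) l (𝓟 _) from
        tendsto_principal.2 (Eventually.of_forall fun m => by simp [hnu]))
    exact this
  have hlam0 : lam ≠ 0 := by rintro rfl; simp at hlam
  have hlim' : Tendsto (fun m : ℕ => conj u ^ (m + 2)) l (𝓝 (conj lam)) := by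
    have := (Complex.continuous_conj.tendsto lam).comp hlim
    refine this.congr fun m => ?_
    simp
  obtain ⟨⟨ζ₀, hζ₀, hz₀⟩, ζ₁, hz₁⟩ := exists_nonreal_zero_exp_sum (A := u - conj u)
    (B := lam * (conj u - 1)) (E := -(conj lam * (u - 1))) hsub (mul_ne_zero hlam0 hu1') hδre hδim
  set V₀ : ℂ := (u - conj u) * (u - 1) * (conj u - 1) with hV₀
  have hV₀0 : V₀ ≠ 0 := mul_ne_zero (mul_ne_zero hsub hu1) hu1'
  set V : ℂ → ℂ := fun w => (Y₁ w - Y₂ w) * (Y₁ w - Y₀ w) * (Y₂ w - Y₀ w) with hV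
  have hV0 : V 0 = V₀ := by simp only [hV, Y₁0, Y₂0, Y₀0, hV₀]
  have cY₁ := Y₁d.continuousAt
  have cY₂ := Y₂d.continuousAt
  have cY₀ := Y₀d.continuousAt
  have hVc : ContinuousAt V 0 := ((cY₁.sub cY₂).mul (cY₁.sub cY₀)).mul (cY₂.sub cY₀)
  have hσC : (σ : ℂ) ≠ 0 := by exact_mod_cast hσ0
  have hτσC : (σ : ℂ) * (1 + 2 * p) = -1 := by exact_mod_cast hτσ
  have hgC : (b : ℂ) * σ ^ 3 + σ + a = 0 := by exact_mod_cast hg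
  have hVne : ∀ᶠ w in 𝓝 (0 : ℂ), V w ≠ 0 := hVc.eventually_ne (by rw [hV0]; exact hV₀0)
  -- `Y₀, Y₁, Y₂` are the zeros of the rescaled cubic, so partial fractions apply.
  have hpoly : ∀ᶠ w in 𝓝 (0 : ℂ), ∀ m, V w *
      (aeval (-(σ : ℂ) ^ 3 * (1 + w)) (normPoly a b m) / σ ^ m) =
      Y₁ w ^ (m + 2) * (Y₂ w - Y₀ w) - Y₂ w ^ (m + 2) * (Y₁ w - Y₀ w)
        + Y₀ w ^ (m + 2) * (Y₁ w - Y₂ w) := by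
    filter_upwards [Y₁r, Y₂r, hVne] with w r1 r2 hne m
    have hY12 : Y₁ w - Y₂ w ≠ 0 := left_ne_zero_of_mul (left_ne_zero_of_mul hne)
    have s1 : Y₁ w + Y₂ w + Y₀ w = 1 + 2 * p := by simp only [hY₀]; ring
    have s2 : Y₁ w * Y₂ w + Y₂ w * Y₀ w + Y₀ w * Y₁ w = 1 + 2 * p + β * w := by
      apply mul_left_cancel₀ hY12
      rw [show Y₀ w = (1 + 2 * p : ℂ) - Y₁ w - Y₂ w from rfl]
      linear_combination r2 - r1
    have s3 : Y₁ w * Y₂ w * Y₀ w = 1 + w := by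
      have : Y₀ w = (1 + 2 * p : ℂ) - Y₁ w - Y₂ w := rfl
      linear_combination Y₁ w * s2 - Y₁ w ^ 2 * s1 + r1
    have key := vandermonde_mul_aeval_normPoly a b (-(σ : ℂ) ^ 3 * (1 + w)) (σ * Y₁ w)
      (σ * Y₂ w) (σ * Y₀ w) (by linear_combination σ * s1 + hτσC)
      (by
        rw [hβ] at s2; push_cast at s2
        linear_combination (σ : ℂ) ^ 2 * s2 + σ * hτσC - hgC)
      (by linear_combination (σ : ℂ) ^ 3 * s3) m
    simp only [hV]
    simp only [mul_pow] at key
    generalize Y₀ w = y₀ at *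
    rw [mul_div_assoc', div_eq_iff (pow_ne_zero _ hσC)]
    apply mul_left_cancel₀ (pow_ne_zero 3 hσC)
    linear_combination key
  have hev := eventually_exists_zero_of_tendsto (l := (l : Filter ℕ))
    (f := fun m ζ => V₀ * (aeval (-(σ : ℂ) ^ 3 * (1 + ζ / ((m : ℂ) + 2))) (normPoly a b m) / σ ^ m)
      * Complex.exp (-(α₀ * ζ)))
    (F := fun ζ => u - conj u + lam * (conj u - 1) * Complex.exp (δ * ζ)
      + -(conj lam * (u - 1)) * Complex.exp (conj δ * ζ))
    (fun m => by
      have h1 : Differentiable ℂ fun ζ : ℂ =>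
          aeval (-(σ : ℂ) ^ 3 * (1 + ζ / ((m : ℂ) + 2))) (normPoly a b m) :=
        (normPoly a b m).differentiable_aeval.comp
          (g := fun z => aeval z (normPoly a b m))
          (f := fun ζ : ℂ => -(σ : ℂ) ^ 3 * (1 + ζ / ((m : ℂ) + 2))) (by fun_prop)
      fun_prop)
    (by fun_prop)
    (fun ζ => by
      have w0 := tendsto_div_add_two hlat ζ
      have t1 := tendsto_pow_exp hlat (g := fun w => Y₁ w * conj u) (Y₁d.mul_const _)
        (by rw [Y₁0, huu]) ζ
      have t2 := tendsto_pow_exp hlat (g := fun w => Y₂ w * u) (Y₂d.mul_const _)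
        (by rw [Y₂0, mul_comm, huu]) ζ
      have t0 := tendsto_pow_exp hlat Y₀d Y₀0 ζ
      have l1 := hlim.comp (tendsto_fst (f := (l : Filter ℕ)) (g := 𝓝 ζ))
      have l2 := hlim'.comp (tendsto_fst (f := (l : Filter ℕ)) (g := 𝓝 ζ))
      have y1 : Tendsto Y₁ (𝓝 0) (𝓝 u) := Y₁0 ▸ cY₁
      have y2 : Tendsto Y₂ (𝓝 0) (𝓝 (conj u)) := Y₂0 ▸ cY₂
      have y0 : Tendsto Y₀ (𝓝 0) (𝓝 1) := Y₀0 ▸ cY₀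
      have tV : Tendsto V (𝓝 0) (𝓝 V₀) := hV0 ▸ hVc
      have tE : Tendsto (fun x : ℕ × ℂ => Complex.exp (-(α₀ * x.2))) (l ×ˢ 𝓝 ζ)
          (𝓝 (Complex.exp (-(α₀ * ζ)))) :=
        ((by fun_prop : Continuous fun w : ℂ => Complex.exp (-(α₀ * w))).tendsto ζ).comp
          tendsto_snd
      have main := (((tendsto_const_nhds (x := V₀)).div (tV.comp w0) hV₀0).mul
        ((((t1.mul l1).mul ((y2.sub y0).comp w0)).sub
          ((t2.mul l2).mul ((y1.sub y0).comp w0))).add (t0.mul ((y1.sub y2).comp w0)))).mul tE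
      have e : V₀ / V₀ * (Complex.exp (v * conj u * ζ) * lam * (conj u - 1)
          - Complex.exp (conj v * u * ζ) * conj lam * (u - 1)
          + Complex.exp (α₀ * ζ) * (u - conj u)) * Complex.exp (-(α₀ * ζ))
          = u - conj u + lam * (conj u - 1) * Complex.exp (δ * ζ)
            + -(conj lam * (u - 1)) * Complex.exp (conj δ * ζ) := by
        have e1 : Complex.exp (δ * ζ) = Complex.exp (v * conj u * ζ) * Complex.exp (-(α₀ * ζ)) := by
          rw [← Complex.exp_add]; congr 1; rw [hδ, hα₀]; ring
        have e2 : Complex.exp (conj δ * ζ)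
            = Complex.exp (conj v * u * ζ) * Complex.exp (-(α₀ * ζ)) := by
          rw [← Complex.exp_add]; congr 1; rw [hδ, hα₀]; simp; ring
        have e3 : Complex.exp (α₀ * ζ) * Complex.exp (-(α₀ * ζ)) = 1 := by
          rw [← Complex.exp_add]; simp
        rw [div_self hV₀0, e1, e2]
        linear_combination (u - conj u) * e3
      rw [e] at main
      refine main.congr' ?_
      filter_upwards [w0.eventually hpoly, w0.eventually hVne] with x hx hne
      have hxm := hx x.1
      set w := x.2 / ((x.1 : ℂ) + 2)
      have p1 : (Y₁ w * conj u) ^ (x.1 + 2) * u ^ (x.1 + 2) = Y₁ w ^ (x.1 + 2) := by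
        rw [← mul_pow, mul_assoc, mul_comm (conj u), huu, mul_one]
      have p2 : (Y₂ w * u) ^ (x.1 + 2) * conj u ^ (x.1 + 2) = Y₂ w ^ (x.1 + 2) := by
        rw [← mul_pow, mul_assoc, huu, mul_one]
      simp only [Function.comp_apply, Pi.div_apply]
      change V₀ / V w * _ * _ = _
      rw [p1, p2, ← hxm]
      field_simp)
    hz₀ hz₁ ((isOpen_ne_fun Complex.continuous_im continuous_const).mem_nhds hζ₀)
  obtain ⟨m, ζ, hζ, h0⟩ := hev.exists
  refine ⟨m, -(σ : ℂ) ^ 3 * (1 + ζ / ((m : ℂ) + 2)), ?_, ?_⟩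
  · have := (mul_eq_zero.1 h0).resolve_right (Complex.exp_ne_zero _)
    have := (mul_eq_zero.1 this).resolve_left hV₀0
    exact (div_eq_zero_iff.1 this).resolve_right (pow_ne_zero _ hσC)
  · have hζ : ζ.im ≠ 0 := hζ
    have e : (-(σ : ℂ) ^ 3 * (1 + ζ / ((m : ℂ) + 2))).im = -σ ^ 3 * (ζ.im / (m + 2)) := by
      rw [show (-(σ : ℂ) ^ 3) = ((-σ ^ 3 : ℝ) : ℂ) by push_cast; ring,
        show ((m : ℂ) + 2) = ((m + 2 : ℝ) : ℂ) by push_cast; ring, Complex.im_ofReal_mul,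
        Complex.add_im, Complex.div_ofReal_im]
      simp
    rw [e]
    have : (m + 2 : ℝ) ≠ 0 := by positivity
    exact mul_ne_zero (neg_ne_zero.2 (pow_ne_zero 3 hσ0)) (div_ne_zero hζ this)

/-! ### The equivalence -/

theorem normPoly_hyperbolic_iff {a b : ℝ} (hb : 0 ≤ b) :
    (∀ (m : ℕ) (z : ℂ), aeval z (normPoly a b m) = 0 → z.im = 0) ↔
      (0 ≤ 1 + a + b ∧ 0 ≤ 9 - 27 * a + b) := by
  refine ⟨fun h => ?_, fun h m z hz => im_eq_zero_of_mem_region hb h.1 h.2 m z hz⟩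
  -- Condition (ii) compares the zero `σ` of this increasing function with `1` and `-1/3`.
  obtain ⟨σ, -, hσ⟩ : ∃ σ ∈ Set.Icc (-|a|) |a|, b * σ ^ 3 + σ + a = 0 := by
    have := intermediate_value_Icc (f := fun s : ℝ => b * s ^ 3 + s + a)
      (neg_le_self (abs_nonneg a)) (by fun_prop)
    have h3 : 0 ≤ b * |a| ^ 3 := by positivity
    refine this ⟨?_, ?_⟩
    · have := le_abs_self a
      rw [Odd.neg_pow (by decide)]
      linarith
    · have := neg_abs_le a
      linarith
  have hmono : ∀ s t : ℝ, s ≤ t → b * s ^ 3 + s ≤ b * t ^ 3 + t := fun s t hst =>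
    add_le_add (mul_le_mul_of_nonneg_left (Odd.strictMono_pow (by decide) |>.monotone hst) hb) hst
  by_contra hcon
  suffices hout : 1 < σ ∨ σ < -(1 / 3) by
    obtain ⟨m, z, hz, him⟩ := exists_nonreal_zero hb hσ hout
    exact him (h m z hz)
  by_contra! hin
  have i1 := hmono _ _ hin.1
  have i2 := hmono _ _ hin.2
  norm_num at i1 i2
  exact hcon ⟨by linarith, by linarith⟩

theorem theorem1 (c b₀ b₁ a₀ a₁ a b : ℝ)
    (hsign : c * a₁ * b₁ ≤ 0) (hne : c * a₁ ≠ 0)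
    (ha : a = b₀ / c ^ 2 - b₁ * a₀ / (c ^ 2 * a₁))
    (hb : b = -(b₁ * c / a₁)) :
    (∀ (m : ℕ) (z : ℂ), aeval z (genPoly c b₀ b₁ a₀ a₁ m) = 0 → z.im = 0) ↔
      (0 ≤ 1 + a + b ∧ 0 ≤ 9 - 27 * a + b) := by
  have hc : c ≠ 0 := left_ne_zero_of_mul hne
  have ha1 : a₁ ≠ 0 := right_ne_zero_of_mul hne
  have hb0 : 0 ≤ b := by
    rw [hb, show -(b₁ * c / a₁) = -(c * a₁ * b₁) / a₁ ^ 2 by field_simp]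
    exact div_nonneg (by linarith) (sq_nonneg _)
  rw [← normPoly_hyperbolic_iff hb0]
  have key : ∀ m (z : ℂ), aeval z (genPoly c b₀ b₁ a₀ a₁ m) = (c : ℂ) ^ m *
      aeval (((a₀ : ℂ) + a₁ * z) / (c : ℂ) ^ 3) (normPoly a b m) := by
    intro m z
    rw [ha, hb]
    exact aeval_genPoly_eq c b₀ b₁ a₀ a₁ hne z m
  have hcC : (c : ℂ) ≠ 0 := by exact_mod_cast hc
  have haC : (a₁ : ℂ) ≠ 0 := by exact_mod_cast ha1
  have him : ∀ z : ℂ, (((a₀ : ℂ) + a₁ * z) / (c : ℂ) ^ 3).im = a₁ * z.im / c ^ 3 := by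
    intro z
    rw [← Complex.ofReal_pow, Complex.div_ofReal_im, Complex.add_im, Complex.im_ofReal_mul,
      Complex.ofReal_im, zero_add]
  constructor
  · intro h m w hw
    have hz := h m (((c : ℂ) ^ 3 * w - a₀) / a₁) (by
      rw [key, show ((a₀ : ℂ) + a₁ * (((c : ℂ) ^ 3 * w - a₀) / a₁)) / (c : ℂ) ^ 3 = w by
        field_simp; ring, hw, mul_zero])
    have := him (((c : ℂ) ^ 3 * w - a₀) / a₁)
    rw [hz, show ((a₀ : ℂ) + a₁ * (((c : ℂ) ^ 3 * w - a₀) / a₁)) / (c : ℂ) ^ 3 = w by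
        field_simp; ring] at this
    simpa using this
  · intro h m z hz
    rw [key] at hz
    have h0 := h m _ ((mul_eq_zero.1 hz).resolve_left (pow_ne_zero _ hcC))
    rw [him, div_eq_zero_iff] at h0
    exact (mul_eq_zero.1 (h0.resolve_right (pow_ne_zero _ hc))).resolve_left ha1
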